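/- For a poset $P$, let $\Sigma P$ denote its Scott space: $P$ with the topology whose open sets are the upper sets $U$ such that $\bigvee D\in U$ implies $D\cap U\neq\emptyset$ for every nonempty directed $D\subseteq P$ having a supremum. A space is sober if every nonempty irreducible closed set is the closure of a unique point. Let $\mathcal D(P)$ be the set of all nonempty compact saturated subsets of $\Sigma P$, ordered by reverse inclusion (a set is saturated if it is the intersection of all open sets containing it). A complete Heyting algebra (frame) is a complete lattice in which $a\wedge\bigvee_i a_i=\bigvee_i(a\wedge a_i)$ always holds; it is a spatial frame if every element is a meet of prime elements, where $p$ is prime if $a\wedge b\le p$ implies $a\le p$ or $b\le p$. There exists a complete lattice $M$ whose Scott space $\Sigma M$ is non-sober and for which $\mathcal D(M)$ is a complete Heyting algebra, indeed a spatial frame, whose Scott space $\Sigma\mathcal D(M)$ is non-sober. Moreover, for every complete lattice $M$ with non-sober Scott space (in particular, for the one constructed by Isbell), $\mathcal D(M)$ is a complete Heyting algebra, indeed a spatial frame, and its Scott space is non-sober. Since every complete Heyting algebra is distributive, there is in particular a distributive complete lattice whose Scott space is non-sober, which answers Jung's question. -/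

import Mathlib

/-!
For a poset `P`, the points `↑x` embed `ΣP` continuously into `Σ𝒟(P)`. When `ΣP` is well-filtered,
the compact saturated sets meeting a closed set `A` form a Scott closed set, namely the closure of
`{↑x | x ∈ A}`. So if `A` is irreducible and `Σ𝒟(P)` is sober, this set has a largest element `K`,
and any point of `K ∩ A` is a generic point of `A`. Hence non-sobriety passes from `ΣP` to `Σ𝒟(P)`.

In a complete lattice, `x ↦ x ⊔ y` is Scott continuous. With compactness this makes `ΣM` coherent
and makes `↓(A ∩ K)` closed for `A` closed and `K` compact saturated; the latter forces `ΣM` to be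
well-filtered (Xi and Lawson). Therefore intersections of compact saturated sets are again such, the
lattice operations of `𝒟(M)` are unions and intersections of sets, and the `↑x` are prime.

A complete lattice with non-sober Scott space arises from an irreducible sequential space `X` with
at least two points in which compact sets are closed: take the compact sets, together with `X`
itself, ordered by reverse inclusion. The nonempty ones form the closure of the image of `X` under
the continuous map `x ↦ {x}`, an irreducible closed set without largest element. Such an `X` is
built by attaching to any two points `p`, `q` an infinitely branching tree, in which the children of
each node converge to `p` and each branch converges to `q`: a nonempty open set around `p` then
contains all but the root of a whole branch, whose nodes are eventually in a given neighbourhood of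
`q`.
-/


/-- A topological space is sober if every (nonempty) irreducible closed set is the closure of a
unique singleton. -/
def IsSober (X : Type*) [TopologicalSpace X] : Prop :=
  ∀ F : Set X, IsIrreducible F → IsClosed F → ∃! x : X, closure {x} = F

/-- A set is saturated if it equals the intersection of all open sets containing it. -/
def IsSaturatedSet {X : Type*} [TopologicalSpace X] (A : Set X) : Prop :=
  A = ⋂₀ {U : Set X | IsOpen U ∧ A ⊆ U}

/-- The set of all nonempty compact saturated subsets of a topological space. -/
@[ext]
structure CompactSaturated (X : Type*) [TopologicalSpace X] where
  carrier : Set X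
  nonempty : carrier.Nonempty
  isCompact : IsCompact carrier
  isSaturated : IsSaturatedSet carrier

/-- The nonempty compact saturated subsets are ordered by reverse inclusion. -/
instance CompactSaturated.instPartialOrder (X : Type*) [TopologicalSpace X] :
    PartialOrder (CompactSaturated X) where
  le K₁ K₂ := K₂.carrier ⊆ K₁.carrier
  le_refl K := subset_refl K.carrier
  le_trans _ _ _ h₁ h₂ := subset_trans h₂ h₁
  le_antisymm _ _ h₁ h₂ := CompactSaturated.ext (subset_antisymm h₂ h₁)

/-- The poset `𝒟(P)` of all nonempty compact saturated subsets of the Scott space of a poset `P`,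
ordered by reverse inclusion. -/
abbrev ScottCompactSaturated (P : Type*) [PartialOrder P] : Type _ :=
  CompactSaturated (Topology.WithScott P)

/-- Prime elements of a meet-semilattice (the top element, if there is one, counts as prime). -/
def IsPrimeElement {S : Type*} [SemilatticeInf S] (p : S) : Prop :=
  ∀ a b : S, a ⊓ b ≤ p → a ≤ p ∨ b ≤ p

/-- A poset is a complete Heyting algebra (a frame) if its own order carries such a structure. -/
def IsCompleteHeytingAlgebra (P : Type*) [inst : PartialOrder P] : Prop :=
  ∃ F : Order.Frame P, F.toPartialOrder = inst

/-- A poset is a spatial frame if its own order makes it a complete Heyting algebra in which every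
element is a meet of prime elements. -/
def IsSpatialFrame (P : Type*) [inst : PartialOrder P] : Prop :=
  ∃ F : Order.Frame P, F.toPartialOrder = inst ∧
    ∀ a : P, ∃ S : Set P, (∀ p ∈ S, IsPrimeElement p) ∧ a = sInf S

open Set Topology

theorem IsSpatialFrame.isCompleteHeytingAlgebra {P : Type*} [PartialOrder P]
    (h : IsSpatialFrame P) : IsCompleteHeytingAlgebra P :=
  let ⟨F, hF, _⟩ := h
  ⟨F, hF⟩

section TopologicalSpace

variable {X : Type*} [TopologicalSpace X]

theorem isSober_iff_quasiSober [T0Space X] : IsSober X ↔ QuasiSober X := by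
  rw [quasiSober_iff]
  exact forall₃_congr fun F _ _ =>
    ⟨ExistsUnique.exists, fun ⟨x, hx⟩ => ⟨x, hx, fun _ hy => IsGenericPoint.eq hy hx⟩⟩

theorem isSaturatedSet_iff_nhdsKer_eq {A : Set X} : IsSaturatedSet A ↔ nhdsKer A = A := by
  rw [IsSaturatedSet, ← nhdsKer_def, eq_comm]

theorem isSaturatedSet_iInter {ι : Sort*} {A : ι → Set X} (hA : ∀ i, IsSaturatedSet (A i)) :
    IsSaturatedSet (⋂ i, A i) := by
  simp only [isSaturatedSet_iff_nhdsKer_eq] at hA ⊢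
  refine subset_antisymm (nhdsKer_iInter_subset.trans ?_) subset_nhdsKer
  simp only [hA, subset_rfl]

theorem IsSaturatedSet.union {A B : Set X} (hA : IsSaturatedSet A) (hB : IsSaturatedSet B) :
    IsSaturatedSet (A ∪ B) := by
  simp only [isSaturatedSet_iff_nhdsKer_eq, nhdsKer_union] at *
  rw [hA, hB]

theorem IsSaturatedSet.inter {A B : Set X} (hA : IsSaturatedSet A) (hB : IsSaturatedSet B) :
    IsSaturatedSet (A ∩ B) :=
  inter_eq_iInter ▸ isSaturatedSet_iInter (Bool.forall_bool.2 ⟨hB, hA⟩)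

theorem isSaturatedSet_nhdsKer (A : Set X) : IsSaturatedSet (nhdsKer A) :=
  isSaturatedSet_iff_nhdsKer_eq.2 (nhdsKer_nhdsKer A)

theorem IsSaturatedSet.mem_of_specializes {A : Set X} (hA : IsSaturatedSet A) {x y : X}
    (h : y ⤳ x) (hx : x ∈ A) : y ∈ A := by
  rw [← isSaturatedSet_iff_nhdsKer_eq.1 hA]
  exact mem_nhdsKer_iff_specializes.2 ⟨x, hx, h⟩

theorem isCompact_of_forall_directed_cover.{u} {Y : Type u} [TopologicalSpace Y] {K : Set Y}
    (h : ∀ {ι : Type u} [Nonempty ι] (U : ι → Set Y), (∀ i, IsOpen (U i)) →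
      Directed (· ⊆ ·) U → K ⊆ ⋃ i, U i → ∃ i, K ⊆ U i) : IsCompact K := by
  refine isCompact_of_finite_subcover fun {ι} U hU hK => ?_
  exact h (fun t : Finset ι => ⋃ i ∈ t, U i) (fun t => isOpen_biUnion fun i _ => hU i)
    (directed_of_isDirected_le fun _ _ hst => biUnion_subset_biUnion_left hst)
    (iUnion_eq_iUnion_finset U ▸ hK)

theorem eq_of_tendsto_of_frequently_eq [T1Space X] {ι : Type*} {l : Filter ι} {u : ι → X}
    {x y : X} (hu : Filter.Tendsto u l (𝓝 x)) (hy : ∃ᶠ i in l, u i = y) : x = y := by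
  simpa only [closure_singleton, mem_singleton_iff] using
    mem_closure_of_frequently_of_tendsto (s := {y}) hy hu

theorem exists_minimal_isClosed_inter_nonempty {𝒦 : Set (Set X)} (h𝒦 : ∀ K ∈ 𝒦, IsCompact K)
    {C₀ : Set X} (hC₀ : IsClosed C₀) (hmeet : ∀ K ∈ 𝒦, (K ∩ C₀).Nonempty) :
    ∃ C ⊆ C₀, Minimal (fun C => IsClosed C ∧ ∀ K ∈ 𝒦, (K ∩ C).Nonempty) C := by
  refine zorn_superset_nonempty {C | IsClosed C ∧ ∀ K ∈ 𝒦, (K ∩ C).Nonempty}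
    (fun c hc hchain hne => ⟨⋂₀ c, ⟨isClosed_sInter fun C hC => (hc hC).1, fun K hK => ?_⟩,
      fun C hC => sInter_subset_of_mem hC⟩) C₀ ⟨hC₀, hmeet⟩
  have : Nonempty c := hne.to_subtype
  by_contra hempty
  rw [not_nonempty_iff_eq_empty, sInter_eq_iInter] at hempty
  obtain ⟨C, hC⟩ := (h𝒦 K hK).elim_directed_family_closed (fun C : c => C.1)
    (fun C => (hc C.2).1) hempty fun C D => (hchain.total C.2 D.2).elim
      (fun h => ⟨C, subset_rfl, h⟩) fun h => ⟨D, h, subset_rfl⟩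
  exact ((hc C.2).2 K hK).ne_empty hC

end TopologicalSpace

namespace CompactSaturated

variable {X : Type*} [TopologicalSpace X]

instance : SemilatticeInf (CompactSaturated X) where
  inf K₁ K₂ :=
    { carrier := K₁.carrier ∪ K₂.carrier
      nonempty := K₁.nonempty.inl
      isCompact := K₁.isCompact.union K₂.isCompact
      isSaturated := K₁.isSaturated.union K₂.isSaturated }
  inf_le_left _ _ := subset_union_left
  inf_le_right _ _ := subset_union_right
  le_inf _ _ _ h₁ h₂ := union_subset h₁ h₂

theorem mem_inf {K₁ K₂ : CompactSaturated X} {x : X} :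
    x ∈ (K₁ ⊓ K₂).carrier ↔ x ∈ K₁.carrier ∨ x ∈ K₂.carrier :=
  Iff.rfl

/-- The smallest compact saturated set containing a given point. In a Scott space it is the
principal filter `↑x`. -/
def principal (x : X) : CompactSaturated X where
  carrier := nhdsKer {x}
  nonempty := ⟨x, subset_nhdsKer rfl⟩
  isCompact := isCompact_singleton.nhdsKer
  isSaturated := isSaturatedSet_nhdsKer {x}

theorem mem_principal {x y : X} : y ∈ (principal x).carrier ↔ y ⤳ x :=
  mem_nhdsKer_singleton

theorem le_principal {K : CompactSaturated X} {x : X} : K ≤ principal x ↔ x ∈ K.carrier :=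
  ⟨fun h => h (mem_principal.2 specializes_rfl),
    fun hx _ hy => K.isSaturated.mem_of_specializes (mem_principal.1 hy) hx⟩

theorem isPrimeElement_principal (x : X) : IsPrimeElement (principal x) := fun _ _ h => by
  simpa only [le_principal, mem_inf] using h

theorem isGLB_principal_image (K : CompactSaturated X) : IsGLB (principal '' K.carrier) K := by
  refine ⟨forall_mem_image.2 fun _ hx => le_principal.2 hx, fun L hL x hx => ?_⟩
  exact le_principal.1 (hL (mem_image_of_mem principal hx))

theorem isLUB_of_carrier_eq_iInter {𝒮 : Set (CompactSaturated X)} {K : CompactSaturated X}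
    (hK : K.carrier = ⋂ L ∈ 𝒮, L.carrier) : IsLUB 𝒮 K :=
  ⟨fun _ hL => hK.trans_subset (biInter_subset_of_mem hL),
    fun _ hT _ hx => hK.superset (mem_iInter₂.2 fun _ hL => hT hL hx)⟩

theorem exists_carrier_eq_iInter {𝒮 : Set (CompactSaturated X)}
    (hne : (⋂ L ∈ 𝒮, L.carrier).Nonempty) (hc : IsCompact (⋂ L ∈ 𝒮, L.carrier)) :
    ∃ K : CompactSaturated X, K.carrier = ⋂ L ∈ 𝒮, L.carrier :=
  ⟨⟨_, hne, hc, isSaturatedSet_iInter fun L => isSaturatedSet_iInter fun _ => L.isSaturated⟩, rfl⟩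

section Frame

variable (hX : ∀ 𝒮 : Set (CompactSaturated X),
  ∃ K : CompactSaturated X, K.carrier = ⋂ L ∈ 𝒮, L.carrier)

/-- The complete lattice of compact saturated sets of a space in which they are closed under
intersections; suprema are intersections and binary infima are unions. -/
@[reducible]
noncomputable def completeLatticeOfInter : CompleteLattice (CompactSaturated X) where
  __ := @completeLatticeOfSup (CompactSaturated X) _ ⟨fun 𝒮 => (hX 𝒮).choose⟩
    fun 𝒮 => isLUB_of_carrier_eq_iInter (hX 𝒮).choose_spec
  inf := (· ⊓ ·)
  inf_le_left _ _ := inf_le_left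
  inf_le_right _ _ := inf_le_right
  le_inf _ _ _ := le_inf

/-- The frame structure on the lattice `CompactSaturated.completeLatticeOfInter`. -/
@[reducible]
noncomputable def frameOfInter : Order.Frame (CompactSaturated X) :=
  letI := completeLatticeOfInter hX
  .ofMinimalAxioms
    { inf_sSup_le_iSup_inf := fun K 𝒮 x hx => by
        refine (or_iff_not_imp_left (a := x ∈ K.carrier)).2 fun hxK => ?_
        have hmem (L : CompactSaturated X) (hL : L ∈ 𝒮) : x ∈ L.carrier :=
          (mem_inf.1 (le_iSup₂ (f := fun L (_ : L ∈ 𝒮) => K ⊓ L) L hL hx)).resolve_left hxK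
        exact (hX 𝒮).choose_spec.superset (mem_iInter₂.2 hmem) }

include hX in
theorem isSpatialFrame_of_forall_exists_carrier_eq_iInter :
    IsSpatialFrame (CompactSaturated X) :=
  letI := frameOfInter hX
  ⟨frameOfInter hX, rfl, fun K => ⟨principal '' K.carrier,
    forall_mem_image.2 fun x _ => isPrimeElement_principal x,
    (isGLB_principal_image K).sInf_eq.symm⟩⟩

end Frame

end CompactSaturated

open CompactSaturated

/-- Well-filtered spaces: an open set containing the intersection of a filtered family of nonempty
compact saturated sets contains a member of the family. Filtered families are directed in the
reverse inclusion order of `CompactSaturated X`. -/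
def IsWellFiltered (X : Type*) [TopologicalSpace X] : Prop :=
  ∀ ⦃𝒮 : Set (CompactSaturated X)⦄, 𝒮.Nonempty → DirectedOn (· ≤ ·) 𝒮 →
    ∀ ⦃U : Set X⦄, IsOpen U → ⋂ K ∈ 𝒮, K.carrier ⊆ U → ∃ K ∈ 𝒮, K.carrier ⊆ U

namespace IsWellFiltered

variable {X : Type*} [TopologicalSpace X] (hX : IsWellFiltered X)

include hX

theorem exists_carrier_eq_iInter_of_directedOn {𝒮 : Set (CompactSaturated X)} (hne : 𝒮.Nonempty)
    (hdir : DirectedOn (· ≤ ·) 𝒮) : ∃ K : CompactSaturated X, K.carrier = ⋂ L ∈ 𝒮, L.carrier := by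
  refine exists_carrier_eq_iInter ?_ (isCompact_of_finite_subcover fun U hU hcover => ?_)
  · by_contra hempty
    obtain ⟨K, -, hK⟩ := hX hne hdir isOpen_empty (not_nonempty_iff_eq_empty.1 hempty).subset
    exact K.nonempty.not_subset_empty hK
  · obtain ⟨K, hK, hKU⟩ := hX hne hdir (isOpen_iUnion hU) hcover
    obtain ⟨t, ht⟩ := K.isCompact.elim_finite_subcover U hU hKU
    exact ⟨t, (biInter_subset_of_mem hK).trans ht⟩

theorem isClosed_setOf_inter_nonempty [TopologicalSpace (CompactSaturated X)]
    [IsScott (CompactSaturated X) univ] {A : Set X} (hA : IsClosed A) :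
    IsClosed {K : CompactSaturated X | (K.carrier ∩ A).Nonempty} := by
  refine IsScott.isClosed_iff_isLowerSet_and_dirSupClosed.2
    ⟨fun K L hLK hK => hK.mono (inter_subset_inter_left A hLK), fun 𝒮 h𝒮 hne hdir K hK => ?_⟩
  obtain ⟨L, hL⟩ := hX.exists_carrier_eq_iInter_of_directedOn hne hdir
  obtain rfl : K = L := hK.unique (isLUB_of_carrier_eq_iInter hL)
  by_contra hdisj
  obtain ⟨T, hT, hTA⟩ := hX hne hdir hA.isOpen_compl
    (hL ▸ disjoint_iff_inter_eq_empty.2 (not_nonempty_iff_eq_empty.1 hdisj) |>.subset_compl_right)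
  obtain ⟨x, hxT, hxA⟩ := h𝒮 hT
  exact hTA hxT hxA

theorem closure_principal_image [TopologicalSpace (CompactSaturated X)]
    [IsScott (CompactSaturated X) univ] {A : Set X} (hA : IsClosed A) :
    closure (principal '' A) = {K : CompactSaturated X | (K.carrier ∩ A).Nonempty} := by
  refine subset_antisymm (closure_minimal (forall_mem_image.2 fun x hx => ?_)
    (hX.isClosed_setOf_inter_nonempty hA)) fun K ⟨x, hxK, hxA⟩ => ?_
  · exact ⟨x, mem_principal.2 specializes_rfl, hx⟩
  · exact IsScott.isLowerSet_of_isClosed isClosed_closure (le_principal.2 hxK)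
      (subset_closure (mem_image_of_mem principal hxA))

theorem quasiSober_of_compactSaturated [TopologicalSpace (CompactSaturated X)]
    [IsScott (CompactSaturated X) univ] [QuasiSober (CompactSaturated X)]
    (hcont : Continuous (principal : X → CompactSaturated X)) : QuasiSober X := by
  refine ⟨fun {A} hirr hA => ?_⟩
  obtain ⟨K, hK⟩ := QuasiSober.sober (hirr.image principal hcont.continuousOn).closure
    isClosed_closure
  have hKA : (K.carrier ∩ A).Nonempty := (hX.closure_principal_image hA).subset hK.mem
  obtain ⟨a, haK, haA⟩ := hKA
  refine ⟨a, (isGenericPoint_iff_forall_closed hA haA).2 fun Z hZ haZ b hb => ?_⟩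
  have hb_le : principal b ≤ K := by
    have := hK.specializes (subset_closure (mem_image_of_mem principal hb))
    rwa [specializes_iff_mem_closure, IsScott.closure_singleton] at this
  exact (mem_principal.1 (hb_le haK)).mem_closed hZ haZ

theorem isSpatialFrame [CompactSpace X] [Nonempty X]
    (hinter : ∀ K₁ K₂ : CompactSaturated X,
      ∃ K : CompactSaturated X, K.carrier = K₁.carrier ∩ K₂.carrier) :
    IsSpatialFrame (CompactSaturated X) := by
  refine isSpatialFrame_of_forall_exists_carrier_eq_iInter fun 𝒮 => ?_
  -- The compact saturated sets containing `⋂ 𝒮` have the same intersection and form a directed set.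
  set 𝒯 : Set (CompactSaturated X) := {K | ⋂ L ∈ 𝒮, L.carrier ⊆ K.carrier}
  have hne : 𝒯.Nonempty :=
    ⟨⟨univ, univ_nonempty, isCompact_univ, isSaturatedSet_iff_nhdsKer_eq.2 nhdsKer_univ⟩,
      subset_univ _⟩
  have hdir : DirectedOn (· ≤ ·) 𝒯 := fun K₁ hK₁ K₂ hK₂ => by
    obtain ⟨K, hK⟩ := hinter K₁ K₂
    exact ⟨K, (subset_inter hK₁ hK₂).trans hK.superset, hK.trans_subset inter_subset_left,
      hK.trans_subset inter_subset_right⟩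
  obtain ⟨K, hK⟩ := hX.exists_carrier_eq_iInter_of_directedOn hne hdir
  refine ⟨K, hK.trans (subset_antisymm ?_ (subset_iInter₂ fun _ hL => hL))⟩
  exact biInter_subset_biInter_left fun L hL => biInter_subset_of_mem hL

end IsWellFiltered

section Scott

theorem continuous_of_scottContinuous {P Q : Type*} [Preorder P] [TopologicalSpace P]
    [IsScott P univ] [Preorder Q] [TopologicalSpace Q] [IsScott Q univ] {f : P → Q}
    (hf : ScottContinuous f) : Continuous f :=
  (IsScott.scottContinuousOn_iff_continuous fun _ _ _ => mem_univ _).1 hf.scottContinuousOn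

variable {P : Type*} [TopologicalSpace P]

namespace CompactSaturated

variable [Preorder P] [IsScott P univ]

theorem mem_principal_iff_le {x y : P} : y ∈ (principal x).carrier ↔ x ≤ y := by
  rw [mem_principal, specializes_iff_mem_closure, IsScott.closure_singleton, mem_Iic]

theorem isUpperSet_carrier (K : CompactSaturated P) : IsUpperSet K.carrier := fun _ _ hxy hx =>
  K.isSaturated.mem_of_specializes (mem_principal.1 (mem_principal_iff_le.2 hxy)) hx

theorem scottContinuous_principal : ScottContinuous (principal : P → CompactSaturated P) := by
  intro d _ _ a ha
  refine isLUB_of_carrier_eq_iInter (Set.ext fun y => ?_)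
  simp only [biInter_image, mem_iInter, mem_principal_iff_le]
  exact isLUB_le_iff ha

end CompactSaturated

theorem IsWellFiltered.isSober_of_isSober_compactSaturated [PartialOrder P] [IsScott P univ]
    [TopologicalSpace (CompactSaturated P)] [IsScott (CompactSaturated P) univ]
    (hP : IsWellFiltered P) (h : IsSober (CompactSaturated P)) : IsSober P := by
  have : QuasiSober (CompactSaturated P) := isSober_iff_quasiSober.1 h
  exact isSober_iff_quasiSober.2
    (hP.quasiSober_of_compactSaturated (continuous_of_scottContinuous scottContinuous_principal))

section SemilatticeSup

variable [SemilatticeSup P] [IsScott P univ]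

theorem continuous_sup_const (y : P) : Continuous fun x : P => x ⊔ y :=
  continuous_of_scottContinuous (by fun_prop)

theorem continuous_const_sup (x : P) : Continuous fun y : P => x ⊔ y :=
  continuous_of_scottContinuous (by fun_prop)

theorem isOpen_setOf_forall_sup_mem {K U : Set P} (hK : IsCompact K) (hU : IsOpen U) :
    IsOpen {x | ∀ y ∈ K, x ⊔ y ∈ U} := by
  have hUup : IsUpperSet U := IsScott.isUpperSet_of_isOpen (D := univ) hU
  refine (IsScott.isOpen_iff_isUpperSet_and_dirSupInaccOn (D := univ)).2
    ⟨fun x x' hx h y hy => hUup (sup_le_sup_right hx y) (h y hy),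
      fun d _ hne hdir a ha haK => ?_⟩
  have : Nonempty d := hne.to_subtype
  have hcover : K ⊆ ⋃ x : d, {y | x.1 ⊔ y ∈ U} := fun y hy => by
    obtain ⟨x, hxd, hxU⟩ := (IsScott.isOpen_iff_isUpperSet_and_dirSupInaccOn (D := univ)).1
      (hU.preimage (continuous_sup_const y)) |>.2 trivial hne hdir ha (haK y hy)
    exact mem_iUnion.2 ⟨⟨x, hxd⟩, hxU⟩
  obtain ⟨x, hx⟩ := hK.elim_directed_cover (fun x : d => {y | x.1 ⊔ y ∈ U})
    (fun x => hU.preimage (continuous_const_sup x.1)) hcover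
    (hdir.directed_val.mono_comp (g := fun x : P => {y | x ⊔ y ∈ U}) _
      fun _ _ hxx' y hy => hUup (sup_le_sup_right hxx' y) hy)
  exact ⟨x, x.2, fun y hy => hx hy⟩

theorem isCompact_inter_of_isUpperSet {K₁ K₂ : Set P} (hK₁ : IsCompact K₁) (hK₂ : IsCompact K₂)
    (h₁ : IsUpperSet K₁) (h₂ : IsUpperSet K₂) : IsCompact (K₁ ∩ K₂) := by
  refine isCompact_of_forall_directed_cover fun {ι} _ U hU hdir hcover => ?_
  have hcover₂ : ∀ x ∈ K₁, ∃ i, ∀ y ∈ K₂, x ⊔ y ∈ U i := fun x hx => by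
    refine hK₂.elim_directed_cover (fun i => (x ⊔ ·) ⁻¹' U i)
      (fun i => (hU i).preimage (continuous_const_sup x)) ?_
      (hdir.mono_comp (g := fun V => (x ⊔ ·) ⁻¹' V) _ fun _ _ hUV => preimage_mono hUV)
    rw [← preimage_iUnion]
    exact fun y hy => hcover ⟨h₁ le_sup_left hx, h₂ le_sup_right hy⟩
  obtain ⟨i, hi⟩ := hK₁.elim_directed_cover (fun i => {x | ∀ y ∈ K₂, x ⊔ y ∈ U i})
    (fun i => isOpen_setOf_forall_sup_mem hK₂ (hU i)) (fun x hx => mem_iUnion.2 (hcover₂ x hx))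
    (hdir.mono_comp (g := fun V => {x | ∀ y ∈ K₂, x ⊔ y ∈ V}) _
      fun _ _ hUV _ hx y hy => hUV (hx y hy))
  exact ⟨i, fun z hz => sup_idem z ▸ hi hz.1 z hz.2⟩

theorem CompactSaturated.exists_carrier_eq_inter (K₁ K₂ : CompactSaturated P) :
    ∃ K : CompactSaturated P, K.carrier = K₁.carrier ∩ K₂.carrier := by
  obtain ⟨x, hx⟩ := K₁.nonempty
  obtain ⟨y, hy⟩ := K₂.nonempty
  exact ⟨⟨K₁.carrier ∩ K₂.carrier,
    ⟨x ⊔ y, K₁.isUpperSet_carrier le_sup_left hx, K₂.isUpperSet_carrier le_sup_right hy⟩,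
    isCompact_inter_of_isUpperSet K₁.isCompact K₂.isCompact K₁.isUpperSet_carrier
      K₂.isUpperSet_carrier,
    K₁.isSaturated.inter K₂.isSaturated⟩, rfl⟩

theorem isClosed_lowerClosure_inter {A : Set P} (hA : IsClosed A) (K : CompactSaturated P) :
    IsClosed (lowerClosure (A ∩ K.carrier) : Set P) := by
  rw [← isOpen_compl_iff]
  convert isOpen_setOf_forall_sup_mem K.isCompact hA.isOpen_compl using 1
  ext x
  simp only [mem_compl_iff, SetLike.mem_coe, mem_lowerClosure, not_exists, not_and, mem_ofPred_eq]
  refine ⟨fun h y hy hxy => ?_, fun h y hy hxy => ?_⟩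
  · exact h (x ⊔ y) ⟨hxy, K.isUpperSet_carrier le_sup_right hy⟩ le_sup_left
  · exact h y hy.2 (mem_of_eq_of_mem (sup_eq_right.2 hxy) hy.1)

end SemilatticeSup

theorem compactSpace_of_orderBot [Preorder P] [OrderBot P] [IsScott P univ] : CompactSpace P := by
  refine ⟨isCompact_of_forall_directed_cover fun U hU _ hcover => ?_⟩
  obtain ⟨i, hi⟩ := mem_iUnion.1 (hcover (mem_univ ⊥))
  exact ⟨i, fun x _ => IsScott.isUpperSet_of_isOpen (D := univ) (hU i) bot_le hi⟩

section CompletePartialOrder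

variable [CompletePartialOrder P] [IsScott P univ]

theorem exists_maximal_mem_of_isClosed {A : Set P} (hA : IsClosed A) (hne : A.Nonempty) :
    ∃ m, Maximal (· ∈ A) m := by
  obtain ⟨a, ha⟩ := hne
  obtain ⟨m, -, hm⟩ := zorn_le_nonempty₀ A (fun c hcA hc y hy =>
    have hsup : IsLUB c (sSup c) := hc.directedOn.isLUB_sSup
    ⟨sSup c, IsScott.dirSupClosed_of_isClosed hA hcA ⟨y, hy⟩ hc.directedOn hsup,
      fun z hz => hsup.1 hz⟩) a ha
  exact ⟨m, hm⟩

theorem isWellFiltered_of_isClosed_lowerClosure_inter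
    (h : ∀ A : Set P, IsClosed A → ∀ K : CompactSaturated P,
      IsClosed (lowerClosure (A ∩ K.carrier) : Set P)) : IsWellFiltered P := by
  intro 𝒮 hne hdir U hU hsub
  by_contra! hmeet
  obtain ⟨C, hCU, hC⟩ := exists_minimal_isClosed_inter_nonempty
    (forall_mem_image.2 fun K (_ : K ∈ 𝒮) => K.isCompact) hU.isClosed_compl
    (forall_mem_image.2 fun K hK => inter_compl_nonempty_iff.2 (hmeet K hK))
  have hClower : IsLowerSet C := IsScott.isLowerSet_of_isClosed hC.prop.1
  have hCK : ∀ K ∈ 𝒮, C ⊆ lowerClosure (C ∩ K.carrier) := fun K hK => by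
    refine hC.le_of_le ⟨h C hC.prop.1 K, forall_mem_image.2 fun L hL => ?_⟩
      (lowerClosure_le (t := ⟨C, hClower⟩) |>.2 inter_subset_left)
    obtain ⟨N, hN, hKN, hLN⟩ := hdir K hK L hL
    obtain ⟨x, hxN, hxC⟩ := hC.prop.2 _ (mem_image_of_mem _ hN)
    exact ⟨x, hLN hxN, subset_lowerClosure ⟨hxC, hKN hxN⟩⟩
  obtain ⟨K₀, hK₀⟩ := hne
  obtain ⟨m, hm⟩ := exists_maximal_mem_of_isClosed hC.prop.1
    (hC.prop.2 _ (mem_image_of_mem _ hK₀)).right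
  refine hCU hm.prop (hsub (mem_iInter₂.2 fun K hK => ?_))
  obtain ⟨y, ⟨hyC, hyK⟩, hmy⟩ := hCK K hK hm.prop
  exact hm.eq_of_le hyC hmy ▸ hyK

end CompletePartialOrder

section CompleteLattice

variable [CompleteLattice P] [IsScott P univ]

theorem isWellFiltered_of_completeLattice : IsWellFiltered P :=
  isWellFiltered_of_isClosed_lowerClosure_inter fun _ => isClosed_lowerClosure_inter

theorem isSpatialFrame_compactSaturated : IsSpatialFrame (CompactSaturated P) :=
  have : CompactSpace P := compactSpace_of_orderBot
  isWellFiltered_of_completeLattice.isSpatialFrame exists_carrier_eq_inter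

end CompleteLattice

end Scott

/-- KC spaces: every compact set is closed. This is what the lattice `CompactOrUniv` needs in place
of the Hausdorff property. -/
class KCSpace (X : Type*) [TopologicalSpace X] : Prop where
  isClosed_of_isCompact : ∀ ⦃K : Set X⦄, IsCompact K → IsClosed K

instance KCSpace.t1Space {X : Type*} [TopologicalSpace X] [KCSpace X] :
    T1Space X :=
  ⟨fun _ => isClosed_of_isCompact isCompact_singleton⟩

/-- The compact subsets of `X` together with `X` itself, ordered by reverse inclusion. -/
@[ext]
structure CompactOrUniv (X : Type*) [TopologicalSpace X] where
  carrier : Set X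
  isCompact_or_eq_univ : IsCompact carrier ∨ carrier = univ

namespace CompactOrUniv

variable {X : Type*} [TopologicalSpace X]

instance : PartialOrder (CompactOrUniv X) where
  le S T := T.carrier ⊆ S.carrier
  le_refl S := subset_refl S.carrier
  le_trans _ _ _ h₁ h₂ := subset_trans h₂ h₁
  le_antisymm _ _ h₁ h₂ := CompactOrUniv.ext (subset_antisymm h₂ h₁)

/-- A point `x` as the element `{x}`. In the Scott topology this is a continuous map on sequential
KC spaces. -/
def single (x : X) : CompactOrUniv X where
  carrier := {x}
  isCompact_or_eq_univ := .inl isCompact_singleton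

theorem le_single {S : CompactOrUniv X} {x : X} : S ≤ single x ↔ x ∈ S.carrier :=
  singleton_subset_iff

theorem exists_isCompact_or_biInter_eq_univ (𝒮 : Set (CompactOrUniv X)) :
    (∃ S ∈ 𝒮, IsCompact S.carrier) ∨ ⋂ S ∈ 𝒮, S.carrier = univ := by
  by_contra! h
  exact h.2 (iInter_eq_univ.2 fun S => iInter_eq_univ.2 fun hS =>
    S.isCompact_or_eq_univ.resolve_left (h.1 S hS))

variable [KCSpace X]

theorem isClosed_carrier (S : CompactOrUniv X) : IsClosed S.carrier :=
  S.isCompact_or_eq_univ.elim (fun h => KCSpace.isClosed_of_isCompact h) (· ▸ isClosed_univ)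

theorem isCompact_or_eq_univ_biInter (𝒮 : Set (CompactOrUniv X)) :
    IsCompact (⋂ S ∈ 𝒮, S.carrier) ∨ ⋂ S ∈ 𝒮, S.carrier = univ :=
  (exists_isCompact_or_biInter_eq_univ 𝒮).imp_left fun ⟨_, hS, hc⟩ =>
    hc.of_isClosed_subset (isClosed_biInter fun T _ => T.isClosed_carrier)
      (biInter_subset_of_mem hS)

instance : SupSet (CompactOrUniv X) :=
  ⟨fun 𝒮 => ⟨⋂ S ∈ 𝒮, S.carrier, isCompact_or_eq_univ_biInter 𝒮⟩⟩

instance : CompleteLattice (CompactOrUniv X) :=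
  completeLatticeOfSup _ fun _ => ⟨fun _ hS => biInter_subset_of_mem hS,
    fun _ hT => subset_iInter₂ fun _ hS => hT hS⟩

theorem nonempty_biInter_of_directedOn {𝒮 : Set (CompactOrUniv X)} (hne : 𝒮.Nonempty)
    (hdir : DirectedOn (· ≤ ·) 𝒮) (h : ∀ S ∈ 𝒮, S.carrier.Nonempty) :
    (⋂ S ∈ 𝒮, S.carrier).Nonempty := by
  rcases exists_isCompact_or_biInter_eq_univ 𝒮 with ⟨S, hS, hc⟩ | huniv
  · by_contra hempty
    have : Nonempty 𝒮 := hne.to_subtype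
    rw [not_nonempty_iff_eq_empty, biInter_eq_iInter] at hempty
    obtain ⟨⟨T, hT⟩, hST⟩ := hc.elim_directed_family_closed (fun T : 𝒮 => T.1.carrier)
      (fun T => T.1.isClosed_carrier) (by rw [hempty, inter_empty]) hdir.directed_val
    obtain ⟨N, hN, hSN, hTN⟩ := hdir S hS T hT
    exact (h N hN).not_subset_empty (hST ▸ subset_inter hSN hTN)
  · obtain ⟨S, hS⟩ := hne
    exact huniv ▸ (h S hS).mono (subset_univ _)

variable [TopologicalSpace (CompactOrUniv X)] [IsScott (CompactOrUniv X) univ]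

theorem isClosed_setOf_carrier_nonempty : IsClosed {S : CompactOrUniv X | S.carrier.Nonempty} := by
  refine IsScott.isClosed_iff_isLowerSet_and_dirSupClosed.2
    ⟨fun S T hTS hS => hS.mono hTS, fun 𝒮 h𝒮 hne hdir S hS => ?_⟩
  rw [hS.unique (isLUB_sSup 𝒮)]
  exact nonempty_biInter_of_directedOn hne hdir h𝒮

theorem closure_range_single :
    closure (range single) = {S : CompactOrUniv X | S.carrier.Nonempty} := by
  refine subset_antisymm (closure_minimal (range_subset_iff.2 singleton_nonempty)
    isClosed_setOf_carrier_nonempty) fun S ⟨x, hx⟩ => ?_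
  exact IsScott.isLowerSet_of_isClosed isClosed_closure (le_single.2 hx)
    (subset_closure (mem_range_self x))

theorem continuous_single [SequentialSpace X] :
    Continuous (single : X → CompactOrUniv X) := by
  refine continuous_iff_isClosed.2 fun F hF => IsSeqClosed.isClosed fun u x hu hux => ?_
  let tail (n : ℕ) : CompactOrUniv X := ⟨insert x (range fun k => u (k + n)),
    .inl ((Filter.tendsto_add_atTop_iff_nat n).2 hux).isCompact_insert_range⟩
  have htail_mem (n : ℕ) : tail n ∈ F := IsScott.isLowerSet_of_isClosed hF
    (le_single.2 (.inr ⟨0, congrArg u (zero_add n)⟩)) (hu n)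
  have htail_mono : Monotone tail := fun m n hmn => by
    refine insert_subset_insert (range_subset_iff.2 fun k => ⟨k + (n - m), ?_⟩)
    exact congrArg u (by lia)
  have hsingle_le : single x ≤ sSup (range tail) := fun y hy => by
    by_contra hyx
    have hy_tail (n : ℕ) : ∃ k, u (k + n) = y :=
      (mem_iInter₂.1 hy (tail n) (mem_range_self n)).resolve_left hyx
    refine hyx (eq_of_tendsto_of_frequently_eq hux
      (Filter.frequently_atTop.2 fun n => ?_)).symm
    obtain ⟨k, hk⟩ := hy_tail n
    exact ⟨k + n, Nat.le_add_left n k, hk⟩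
  exact IsScott.isLowerSet_of_isClosed hF hsingle_le (IsScott.dirSupClosed_of_isClosed hF
    (range_subset_iff.2 htail_mem) (range_nonempty tail) htail_mono.directed_le.directedOn_range
    (isLUB_sSup _))

theorem not_isSober [SequentialSpace X] [IrreducibleSpace X] [Nontrivial X] :
    ¬ IsSober (CompactOrUniv X) := by
  intro hsober
  have hirr : IsIrreducible (closure (range (single : X → CompactOrUniv X))) := by
    rw [← image_univ]
    exact ((IrreducibleSpace.isIrreducible_univ X).image _ continuous_single.continuousOn).closure
  obtain ⟨S, hS, -⟩ := hsober _ hirr isClosed_closure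
  rw [IsScott.closure_singleton] at hS
  obtain ⟨z, hz⟩ : S.carrier.Nonempty :=
    closure_range_single.subset (hS.subset self_mem_Iic)
  have hS_sub (y : X) : S.carrier ⊆ {y} :=
    hS.superset (subset_closure (mem_range_self y))
  obtain ⟨y, hy⟩ := exists_ne z
  exact hy (hS_sub y hz).symm

end CompactOrUniv

section SequenceTopology

open Filter

/-- The finest topology on `X` in which each of the sequences `term i` converges to `lim i`. -/
@[reducible]
def sequenceTopology {X ι : Type*} (lim : ι → X) (term : ι → ℕ → X) : TopologicalSpace X where
  IsOpen U := ∀ i, lim i ∈ U → ∀ᶠ n in atTop, term i n ∈ U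
  isOpen_univ _ _ := .of_forall fun _ => mem_univ _
  isOpen_inter _ _ hU hV i hi := (hU i hi.1).and (hV i hi.2)
  isOpen_sUnion _ h i := fun ⟨U, hU, hi⟩ =>
    (h U hU i hi).mono fun _ hn => mem_sUnion_of_mem hn hU

variable {X ι : Type*} [t : TopologicalSpace X] {lim : ι → X} {term : ι → ℕ → X}
  (ht : t = sequenceTopology lim term)

include ht

theorem isOpen_iff_of_eq_sequenceTopology {U : Set X} :
    IsOpen U ↔ ∀ i, lim i ∈ U → ∀ᶠ n in atTop, term i n ∈ U := by
  rw [ht]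
  rfl

theorem sequentialSpace_of_eq_sequenceTopology : SequentialSpace X := by
  refine ⟨fun s hs => ⟨(isOpen_iff_of_eq_sequenceTopology ht).2 fun i hi => ?_⟩⟩
  by_contra hfreq
  obtain ⟨φ, hφ, hφs⟩ := extraction_of_frequently_atTop (not_eventually.1 hfreq)
  have hlim : Tendsto (term i) atTop (𝓝 (lim i)) := tendsto_nhds.2 fun U hU hiU =>
    (isOpen_iff_of_eq_sequenceTopology ht).1 hU i hiU
  exact hi (hs (fun k => not_not.1 (hφs k)) (hlim.comp hφ.tendsto_atTop))

variable (hinj : ∀ i, Function.Injective (term i))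
  (hfin : ∀ i j, i ≠ j → (range (term i) ∩ range (term j)).Finite)

include hinj hfin

theorem isClosed_insert_lim_of_subset_range {i : ι} {A : Set X} (hA : A ⊆ range (term i)) :
    IsClosed (insert (lim i) A) := by
  refine ⟨(isOpen_iff_of_eq_sequenceTopology ht).2 fun j hj => ?_⟩
  have hij : j ≠ i := by
    rintro rfl
    exact hj (mem_insert _ A)
  have hfinite : (insert (lim i) (range (term j) ∩ range (term i))).Finite :=
    (hfin j i hij).insert _
  rw [← Nat.cofinite_eq_atTop]
  filter_upwards [(hinj j).tendsto_cofinite hfinite.compl_mem_cofinite] with n hn hnA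
  exact hn (hnA.imp_right fun h => ⟨mem_range_self n, hA h⟩)

theorem kcSpace_of_eq_sequenceTopology : KCSpace X := by
  refine ⟨fun K hK => ⟨(isOpen_iff_of_eq_sequenceTopology ht).2 fun i hi => ?_⟩⟩
  let tail (n : ℕ) : Set X := insert (lim i) (term i '' Ici n)
  have htail (n : ℕ) : IsClosed (tail n) :=
    isClosed_insert_lim_of_subset_range ht hinj hfin (image_subset_range _ _)
  have hmono : Monotone fun n => (tail n)ᶜ := fun m n hmn => compl_subset_compl.2
    (insert_subset_insert (image_mono (Ici_subset_Ici.2 hmn)))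
  have hcover : K ⊆ ⋃ n, (tail n)ᶜ := fun x hx => by
    have hx_lim : x ≠ lim i := ne_of_mem_of_not_mem hx hi
    by_cases hrange : x ∈ range (term i)
    · obtain ⟨m, rfl⟩ := hrange
      refine mem_iUnion.2 ⟨m + 1, not_or_intro hx_lim fun ⟨k, hk, hkm⟩ => ?_⟩
      exact (Nat.lt_of_succ_le hk).ne (hinj i hkm.symm)
    · exact mem_iUnion.2 ⟨0, not_or_intro hx_lim fun h => hrange (image_subset_range _ _ h)⟩
  obtain ⟨n, hn⟩ :=
    hK.elim_directed_cover _ (fun n => (htail n).isOpen_compl) hcover hmono.directed_le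
  filter_upwards [eventually_ge_atTop n] with m hm hmK
  exact hn hmK (.inr (mem_image_of_mem _ hm))

end SequenceTopology

theorem exists_forall_eq_apply_res {α : Type*} (N : List α → α) :
    ∃ φ : ℕ → α, ∀ k, φ k = N (PiNat.res φ k) := by
  let path (k : ℕ) : List α := (fun l => N l :: l)^[k] []
  have hpath (k : ℕ) : PiNat.res (fun k => N (path k)) k = path k := by
    induction k with
    | zero => rfl
    | succ k ih => rw [PiNat.res_succ, ih, ← Function.iterate_succ_apply' (fun l => N l :: l)]
  exact ⟨fun k => N (path k), fun k => congrArg N (hpath k).symm⟩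

/-- The points of an irreducible sequential KC space: to all points `p`, `q` a tree with nodes
`node p q l` is attached, whose root is `node p q []` and in which the children of `l` are the lists
`n :: l`. -/
inductive TreePoint : Type
  | base
  | node (p q : TreePoint) (l : List ℕ)

namespace TreePoint

/-- The sequences that define the topology of `TreePoint`: the children of a node of the tree
attached to `p` and `q`, and the nodes on an infinite branch of that tree. -/
inductive ConvergentSeq : Type
  | fan (p q : TreePoint) (l : List ℕ)
  | branch (p q : TreePoint) (φ : ℕ → ℕ)

namespace ConvergentSeq

/-- The prescribed limit of a sequence. -/
def lim : ConvergentSeq → TreePoint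
  | fan p _ _ => p
  | branch _ q _ => q

/-- The terms of a sequence. The entries of `φ` determine the branch starting from the root, and
`PiNat.res φ n` lists the first `n` of them in reverse order. -/
def term : ConvergentSeq → ℕ → TreePoint
  | fan p q l, n => node p q (n :: l)
  | branch p q φ, n => node p q (PiNat.res φ n)

theorem term_injective : ∀ s : ConvergentSeq, Function.Injective s.term
  | fan _ _ _, m, n, h => by
    simp only [term, node.injEq, List.cons.injEq] at h
    exact h.2.2.1
  | branch _ _ φ, m, n, h => by
    simp only [term, node.injEq] at h
    simpa only [PiNat.res_length] using congrArg List.length h.2.2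

theorem finite_range_term_branch_inter {p q p' q' : TreePoint} {φ ψ : ℕ → ℕ}
    (h : branch p q φ ≠ branch p' q' ψ) :
    (range (branch p q φ).term ∩ range (branch p' q' ψ).term).Finite := by
  by_cases hpq : p = p' ∧ q = q'
  · obtain ⟨rfl, rfl⟩ := hpq
    obtain ⟨k, hk⟩ : ∃ k, φ k ≠ ψ k := Function.ne_iff.1 fun hφψ => h (hφψ ▸ rfl)
    refine ((finite_Iic k).image (branch p q φ).term).subset ?_
    rintro _ ⟨⟨m, rfl⟩, n, hn⟩
    simp only [term, node.injEq, true_and] at hn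
    obtain rfl : n = m := by simpa only [PiNat.res_length] using congrArg List.length hn
    exact mem_image_of_mem _ (not_lt.1 fun hkm => hk (PiNat.res_eq_res.1 hn hkm).symm)
  · convert finite_empty
    refine disjoint_iff_inter_eq_empty.1 (disjoint_range_iff.2 fun m n hmn => hpq ?_)
    simp only [term, node.injEq] at hmn
    exact ⟨hmn.1, hmn.2.1⟩

theorem finite_range_term_fan_inter {p q : TreePoint} {l : List ℕ} {s : ConvergentSeq}
    (h : fan p q l ≠ s) : (range (fan p q l).term ∩ range s.term).Finite := by
  cases s with
  | fan p' q' l' =>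
    convert finite_empty
    refine disjoint_iff_inter_eq_empty.1 (disjoint_range_iff.2 fun m n hmn => h ?_)
    simp only [term, node.injEq, List.cons.injEq] at hmn
    obtain ⟨rfl, rfl, -, rfl⟩ := hmn
    rfl
  | branch p' q' φ =>
    refine (finite_singleton ((branch p' q' φ).term (l.length + 1))).subset ?_
    rintro _ ⟨⟨m, hm⟩, n, rfl⟩
    simp only [term, node.injEq] at hm
    have hlen : l.length + 1 = n := by
      simpa only [List.length_cons, PiNat.res_length] using congrArg List.length hm.2.2
    rw [hlen, mem_singleton_iff]

theorem finite_range_term_inter : ∀ s t : ConvergentSeq, s ≠ t →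
    (range s.term ∩ range t.term).Finite
  | fan _ _ _, _, h => finite_range_term_fan_inter h
  | branch _ _ _, fan _ _ _, h => inter_comm _ _ ▸ finite_range_term_fan_inter h.symm
  | branch _ _ _, branch _ _ _, h => finite_range_term_branch_inter h

end ConvergentSeq

instance : TopologicalSpace TreePoint :=
  sequenceTopology ConvergentSeq.lim ConvergentSeq.term

instance : SequentialSpace TreePoint :=
  sequentialSpace_of_eq_sequenceTopology rfl

instance : KCSpace TreePoint :=
  kcSpace_of_eq_sequenceTopology rfl ConvergentSeq.term_injective
    ConvergentSeq.finite_range_term_inter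

instance : Nontrivial TreePoint :=
  ⟨base, node base base [], nofun⟩

theorem exists_node_cons_mem {U : Set TreePoint} (hU : IsOpen U) {p : TreePoint} (hp : p ∈ U)
    (q : TreePoint) (l : List ℕ) : ∃ n, node p q (n :: l) ∈ U :=
  ((isOpen_iff_of_eq_sequenceTopology rfl).1 hU (.fan p q l) hp).exists

instance : IrreducibleSpace TreePoint where
  toNonempty := ⟨base⟩
  isPreirreducible_univ U V hU hV := by
    rintro ⟨p, -, hp⟩ ⟨q, -, hq⟩
    choose N hN using exists_node_cons_mem hU hp q
    obtain ⟨φ, hφ⟩ := exists_forall_eq_apply_res N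
    have hφU (k : ℕ) : node p q (PiNat.res φ (k + 1)) ∈ U := by
      rw [PiNat.res_succ, hφ]
      exact hN _
    have hφV : ∀ᶠ k in Filter.atTop, node p q (PiNat.res φ k) ∈ V :=
      (isOpen_iff_of_eq_sequenceTopology rfl).1 hV (.branch p q φ) hq
    obtain ⟨k, hk⟩ := ((Filter.tendsto_add_atTop_nat 1).eventually hφV).exists
    exact ⟨_, trivial, hφU k, hk⟩

end TreePoint

theorem exists_completeLattice_not_isSober :
    ∃ (M : Type) (_ : CompleteLattice M), ¬ IsSober (WithScott M) :=
  ⟨CompactOrUniv TreePoint, inferInstance,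
    letI : TopologicalSpace (CompactOrUniv TreePoint) := scott _ univ
    haveI : IsScott (CompactOrUniv TreePoint) univ := ⟨rfl⟩
    CompactOrUniv.not_isSober (X := TreePoint)⟩

theorem mainTheorem2_general :
    (∃ (M : Type) (_ : CompleteLattice M), ¬ IsSober (WithScott M)) ∧
    ∀ (M : Type*) [CompleteLattice M],
      IsCompleteHeytingAlgebra (ScottCompactSaturated M) ∧
      IsSpatialFrame (ScottCompactSaturated M) ∧
      (IsSober (WithScott (ScottCompactSaturated M)) → IsSober (WithScott M)) := by
  refine ⟨exists_completeLattice_not_isSober, fun M _ => ?_⟩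
  let : CompleteLattice (WithScott M) := ‹_›
  have : IsScott (WithScott M) univ := ⟨rfl⟩
  let : TopologicalSpace (ScottCompactSaturated M) := scott _ univ
  have : IsScott (ScottCompactSaturated M) univ := ⟨rfl⟩
  have hspatial : IsSpatialFrame (ScottCompactSaturated M) := isSpatialFrame_compactSaturated
  have hsober : IsSober (ScottCompactSaturated M) → IsSober (WithScott M) :=
    isWellFiltered_of_completeLattice.isSober_of_isSober_compactSaturated
  exact ⟨hspatial.isCompleteHeytingAlgebra, hspatial, hsober⟩

theorem mainTheorem2 :
    (∃ (M : Type) (_ : CompleteLattice M),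
      ¬ IsSober (Topology.WithScott M) ∧
      IsCompleteHeytingAlgebra (ScottCompactSaturated M) ∧
      IsSpatialFrame (ScottCompactSaturated M) ∧
      ¬ IsSober (Topology.WithScott (ScottCompactSaturated M))) ∧
    (∀ (M : Type*) [CompleteLattice M],
      ¬ IsSober (Topology.WithScott M) →
      IsCompleteHeytingAlgebra (ScottCompactSaturated M) ∧
      IsSpatialFrame (ScottCompactSaturated M) ∧
      ¬ IsSober (Topology.WithScott (ScottCompactSaturated M))) := by
  obtain ⟨M, hM, hns⟩ := mainTheorem2_general.{0}.1
  exact ⟨⟨M, hM, hns, (mainTheorem2_general.2 M).imp_right (.imp_right (mt · hns))⟩,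
    fun N _ hN => (mainTheorem2_general.2 N).imp_right (.imp_right (mt · hN))⟩
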